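/- Let $p$ be a prime and let $G$ be a Camina $p$-group (every conjugacy class of $G$ not contained in $G'$ is a coset of $G'$) of nilpotency class $2$, with $|G|=p^n$ and $|Z(G)|=p^k$. For a conjugacy class $C$ of $G$ let $A_C$ be the complex $G\times G$ matrix with $(A_C)_{xy}=1$ if $yx^{-1}\in C$ and $0$ otherwise, and let $E_C^*$ be the diagonal matrix with $(E_C^*)_{yy}=(A_C)_{ey}$. Let $T(G)$ be the Terwilliger algebra of the group association scheme of $G$ with base point $e$, i.e. the subalgebra of $M_{|G|}(\mathbb{C})$ generated by all $A_C$ and all $E_C^*$. Then: (1) $G$ has exactly $p^{n-k}-1$ non-central conjugacy classes $C_1,\dots,C_{p^{n-k}-1}$ (put $E_i^*=E_{C_i}^*$), and $Z(G)$ is elementary abelian, so that it has a basis $z_1,\dots,z_k$ ($z_j^p=e$, and each element of $Z(G)$ is uniquely $\prod_j z_j^{a_j}$ with $0\le a_j\le p-1$). (2) $T(G)$ has exactly one minimal two-sided ideal $V$ that does not annihilate the primary module $\operatorname{Span}_{\mathbb C}\{A_C\hat e\}$, where $\hat e$ is the standard basis vector at $e$. This ideal $V$, the primary component, has dimension $c^2$,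 where $c$ is the number of conjugacy classes of $G$. (3) For every basis $z_1,\dots,z_k$ of $Z(G)$ as in (1) and every primitive $p$-th root of unity $\zeta$, write $A_j=A_{\{z_j\}}$ and, for $1\le i\le p^{n-k}-1$ and $\alpha\in\{0,\dots,p-1\}^k\setminus\{0\}$, let \[W_i(\alpha)=\frac1{p^k}\sum_{a_1,\dots,a_k\in\{0,\dots,p-1\}}\ \prod_{j=1}^k\zeta^{\alpha_ja_j}\,(E_i^*A_jE_i^*)^{a_j},\] where a zeroth power $(E_i^*A_jE_i^*)^0$ means $E_i^*$. Each $W_i(\alpha)$ is an idempotent, the two-sided ideal $\mathcal W_i(\alpha)$ of $T(G)$ that it generates is one-dimensional, and the Wedderburn decomposition of $T(G)$, as an internal direct sum of minimal two-sided ideals, is \[T(G)=V\oplus\bigoplus_{i=1}^{p^{n-k}-1}\ \bigoplus_{\alpha\ne0}\mathcal W_i(\alpha).\] -/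

import Mathlib

/-- A group is a Camina group if every conjugacy class outside the derived subgroup `G'` is a
coset of `G'`. -/
def IsCamina (G : Type*) [Group G] : Prop :=
  ∀ g : G, g ∉ commutator G → ∃ x : G, conjugatesOf g = (fun h => x * h) '' (commutator G : Set G)

open scoped IsMulCommutative in
/-- `z 1, …, z k` is a basis of the center as an elementary abelian `p`-group: the `z j` have
`p`-th power `1`, and every central element is uniquely `∏ z j ^ a j` with `0 ≤ a j ≤ p - 1`. -/
def IsCenterBasis {G : Type*} [Group G] (p : ℕ) {k : ℕ} (z : Fin k → Subgroup.center G) : Prop :=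
  (∀ j, z j ^ p = 1) ∧
    Function.Bijective (fun a : Fin k → Fin p => ∏ j, z j ^ (a j : ℕ))

section Scheme

variable (G : Type*) [Group G] [Fintype G] [DecidableEq G]

variable {G} in
open Classical in
/-- The adjacency matrix, in the group association scheme of `G`, of a conjugacy class `C`:
its `(x, y)` entry is `1` if `y x⁻¹ ∈ C` and `0` otherwise. -/
noncomputable def adjacencyMatrix (C : ConjClasses G) : Matrix G G ℂ :=
  Matrix.of fun x y => if y * x⁻¹ ∈ C.carrier then 1 else 0

variable {G} in
/-- The dual idempotent of a conjugacy class with respect to the base point `1`: the diagonal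
matrix whose `(y, y)` entry is the `(1, y)` entry of the adjacency matrix. -/
noncomputable def dualIdempotent (C : ConjClasses G) : Matrix G G ℂ :=
  Matrix.diagonal fun y => adjacencyMatrix C 1 y

/-- The Bose-Mesner algebra of the group association scheme (as a linear span). -/
noncomputable def boseMesner : Submodule ℂ (Matrix G G ℂ) :=
  Submodule.span ℂ (Set.range (adjacencyMatrix (G := G)))

/-- The dual Bose-Mesner algebra with respect to the base point `1` (as a linear span). -/
noncomputable def dualBoseMesner : Submodule ℂ (Matrix G G ℂ) :=
  Submodule.span ℂ (Set.range (dualIdempotent (G := G)))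

/-- The Terwilliger algebra `T(G)` of the group association scheme of `G`, with base point `1`. -/
noncomputable def terwilligerAlgebra : Subalgebra ℂ (Matrix G G ℂ) :=
  Algebra.adjoin ℂ ((boseMesner G : Set (Matrix G G ℂ)) ∪ dualBoseMesner G)

variable {G} in
/-- The adjacency matrix of a class, as an element of `T(G)`. -/
noncomputable def adjacencyT (C : ConjClasses G) : terwilligerAlgebra G :=
  ⟨adjacencyMatrix C, Algebra.subset_adjoin (Or.inl (Submodule.subset_span ⟨C, rfl⟩))⟩

variable {G} in
/-- The dual idempotent of a class, as an element of `T(G)`. -/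
noncomputable def dualT (C : ConjClasses G) : terwilligerAlgebra G :=
  ⟨dualIdempotent C, Algebra.subset_adjoin (Or.inr (Submodule.subset_span ⟨C, rfl⟩))⟩

/-- The primary module: the image of the standard basis vector at the base point `1` under the
Bose-Mesner algebra. -/
noncomputable def primaryModule : Submodule ℂ (G → ℂ) :=
  (boseMesner G).map
    ((LinearMap.applyₗ (Pi.single (1 : G) (1 : ℂ))).comp
      (Matrix.toLin' (R := ℂ) (m := G) (n := G)).toLinearMap)

variable {G} in
/-- A primary component of `T(G)`: a minimal two-sided ideal of `T(G)` that does not annihilate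
the primary module. -/
def IsPrimaryComponent (V : TwoSidedIdeal (terwilligerAlgebra G)) : Prop :=
  IsAtom V ∧ ∃ t ∈ V, ∃ v ∈ primaryModule G, (t : Matrix G G ℂ).mulVec v ≠ 0

variable {G} in
/-- The matrix `W_C(α) = p⁻ᵏ ∑_a ∏_j ζ^(α j * a j) (E_C^* A_j E_C^*)^(a j)`, where `A_j` is the
adjacency matrix of the central class `{z j}`. Powers are taken in the corner algebra with
identity `E_C^*`, i.e. the zeroth power is `E_C^*`. The products are taken in the order of
increasing `j`. -/
noncomputable def characterIdempotent {p k : ℕ} (z : Fin k → Subgroup.center G) (ζ : ℂ)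
    (C : ConjClasses G) (α : Fin k → Fin p) : terwilligerAlgebra G :=
  (1 / (p : ℂ) ^ k) • ∑ a : Fin k → Fin p,
    (List.ofFn fun j : Fin k =>
      ζ ^ ((α j : ℕ) * (a j : ℕ)) •
        (dualT C * (dualT C * adjacencyT (ConjClasses.mk (z j : G)) * dualT C) ^ (a j : ℕ))).prod

end Scheme

section Wedderburn

variable {A : Type*} [Ring A] [Algebra ℂ A]

/-- A two-sided ideal of a complex algebra, as a linear subspace. -/
def idealSubspace (I : TwoSidedIdeal A) : Submodule ℂ A :=
  (TwoSidedIdeal.asIdeal I).restrictScalars ℂ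

open Classical in
/-- `A` is the internal direct sum of the minimal two-sided ideals `I i`. -/
def IsWedderburnDecomposition {ι : Type*} (I : ι → TwoSidedIdeal A) : Prop :=
  (∀ i, IsAtom (I i)) ∧ DirectSum.IsInternal fun i => idealSubspace (I i)

end Wedderburn

/-! Write `Z` for the center. The Camina condition and class two give `Z = G'`, so every non-central
class is a coset of `Z`. This settles part (1): the class equation counts these cosets, and if `g`
is non-central with `g ^ p` central, conjugating `g` to `z g` gives `z ^ p = 1`.

The matrices constant on pairs of classes are spanned by the blocks `E_C^* J E_D^*`, where the
all-ones matrix `J` is the sum of all `A_C`. They form an ideal of `T(G)`, and their multiplication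
is that of a full matrix algebra weighted by class sizes; hence this ideal is minimal of dimension
`c ^ 2` (`isAtom_primaryIdeal`, `finrank_primaryIdeal`). It contains `E_1^*`, which fixes the base
vector, so every other minimal ideal kills the primary module (`isPrimaryComponent_iff`).

On a non-central class `C` the center acts by translation, commuting with `E_C^*`, and `W_C(α)` is
the idempotent of a character of `Z` cut down to `C`. For `α ≠ 0` each generator of `T(G)` acts on
it by a scalar: a dual idempotent by `0` or `1`, a central `A_z` by a character value, and a
non-central `A_D` by `0`, since `A_D A_z = A_D`. So it spans a one-dimensional ideal
(`terwilligerAlgebra_mul_characterMatrix`). For `α = 0` it is a multiple of `E_C^* J E_C^*`, hence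
lies in `V`.

Finally `1 = ∑ E_C^*` lies in the sum of these ideals. Distinct minimal ideals annihilate each
other, so the sum is direct and equal to `T(G)` with no dimension count
(`isWedderburnDecomposition_of_one_mem`). -/

/-! ### Structure of Camina groups of class two -/

section CaminaGroups

variable {G : Type*} [Group G]

theorem commutator_le_center_of_nilpotencyClass_le_two [Group.IsNilpotent G]
    (hclass : Group.nilpotencyClass G ≤ 2) : commutator G ≤ Subgroup.center G := by
  have h := Subgroup.lowerCentralSeries_eq_bot_iff_nilpotencyClass_le (G := G) (n := 2) |>.2 hclass
  rw [Subgroup.lowerCentralSeries_succ, Subgroup.top_lowerCentralSeries_one,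
    Subgroup.commutator_top_right_eq_bot_iff_le_center] at h
  exact h

theorem IsCamina.isConj_iff_mul_inv_mem (hC : IsCamina G) {g : G} (hg : g ∉ commutator G) (y : G) :
    IsConj g y ↔ y * g⁻¹ ∈ commutator G := by
  obtain ⟨x, hx⟩ := hC g hg
  have hmem : ∀ y, IsConj g y ↔ x⁻¹ * y ∈ commutator G := fun y => by
    change y ∈ conjugatesOf g ↔ _
    rw [hx]
    constructor
    · rintro ⟨h, hh, rfl⟩
      simpa using hh
    · exact fun h => ⟨_, h, by simp⟩
  have hxg := (hmem g).1 (IsConj.refl g)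
  rw [hmem y, (inferInstance : (commutator G).Normal).mem_comm_iff (a := y),
    ← Subgroup.mul_mem_cancel_left _ (inv_mem hxg)]
  simp [mul_assoc]

/-- A central element outside `G'` would have a one-element class that is also a coset of `G'`,
forcing `G' = 1` and class at most one. -/
theorem IsCamina.center_eq_commutator (hC : IsCamina G) [Group.IsNilpotent G]
    (hclass : Group.nilpotencyClass G = 2) : Subgroup.center G = commutator G := by
  refine le_antisymm (fun g hg => ?_) (commutator_le_center_of_nilpotencyClass_le_two hclass.le)
  by_contra hgc
  have hbot : commutator G = ⊥ := by
    rw [eq_bot_iff]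
    intro h hh
    have h1 : IsConj g (h * g) := (hC.isConj_iff_mul_inv_mem hgc _).2 (by simpa using hh)
    obtain ⟨c, hc⟩ := isConj_iff.1 h1
    rw [Subgroup.mem_center_iff.1 hg c] at hc
    simpa using hc.symm
  rw [← Subgroup.top_lowerCentralSeries_one,
    Subgroup.lowerCentralSeries_eq_bot_iff_nilpotencyClass_le] at hbot
  omega

/-- In a Camina group of class two the class of a non-central element is a coset of the center. -/
theorem IsCamina.isConj_iff_mem_center (hC : IsCamina G) [Group.IsNilpotent G]
    (hclass : Group.nilpotencyClass G = 2) {g : G} (hg : g ∉ Subgroup.center G) (y : G) :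
    IsConj g y ↔ y * g⁻¹ ∈ Subgroup.center G := by
  rw [hC.center_eq_commutator hclass] at hg ⊢
  exact hC.isConj_iff_mul_inv_mem hg y

theorem exists_notMem_pow_mem_of_isPGroup {p : ℕ} (hG : IsPGroup p G) {H : Subgroup G}
    (hH : H ≠ ⊤) : ∃ g, g ∉ H ∧ g ^ p ∈ H := by
  obtain ⟨g, hg⟩ : ∃ g, g ∉ H := by
    by_contra! h
    exact hH (eq_top_iff.2 fun g _ => h g)
  obtain ⟨m, hm⟩ := hG g
  have hex : ∃ m, g ^ p ^ m ∈ H := ⟨m, hm ▸ H.one_mem⟩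
  classical
  -- The last `p`-power of `g` before the sequence enters `H` is the witness.
  obtain ⟨l, hl⟩ : ∃ l, Nat.find hex = l + 1 := Nat.exists_eq_succ_of_ne_zero fun h => by
    have := Nat.find_spec hex
    rw [h] at this
    exact hg (by simpa using this)
  refine ⟨g ^ p ^ l, Nat.find_min hex (by omega), ?_⟩
  have := Nat.find_spec hex
  rwa [hl, pow_succ, pow_mul] at this

theorem IsCamina.center_pow_eq_one (hC : IsCamina G) [Group.IsNilpotent G]
    (hclass : Group.nilpotencyClass G = 2) {p : ℕ} (hG : IsPGroup p G)
    (z : Subgroup.center G) : z ^ p = 1 := by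
  have htop : Subgroup.center G ≠ ⊤ := fun h => by
    have hbot : commutator G = ⊥ := by
      rw [commutator_def, Subgroup.commutator_eq_bot_iff_le_centralizer, Subgroup.coe_top,
        Subgroup.centralizer_univ, h]
    rw [← Subgroup.top_lowerCentralSeries_one,
      Subgroup.lowerCentralSeries_eq_bot_iff_nilpotencyClass_le] at hbot
    omega
  obtain ⟨g, hg, hgp⟩ := exists_notMem_pow_mem_of_isPGroup hG htop
  -- Raising `c g c⁻¹ = z g` to the power `p` leaves `g ^ p` fixed on the left, as it is central,
  -- and gives `z ^ p g ^ p` on the right.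
  have h1 : IsConj g (z * g) := (hC.isConj_iff_mem_center hclass hg _).2 (by simp)
  obtain ⟨c, hc⟩ := isConj_iff.1 h1
  have h2 : c * g ^ p * c⁻¹ = (z : G) ^ p * g ^ p := by
    rw [← conj_pow, hc, Commute.mul_pow]
    exact (Subgroup.mem_center_iff.1 z.2 g).symm
  rw [Subgroup.mem_center_iff.1 hgp c] at h2
  ext
  simpa using h2.symm

theorem IsCamina.card_noncenter [Finite G] (hC : IsCamina G) [Group.IsNilpotent G]
    (hclass : Group.nilpotencyClass G = 2) :
    Nat.card (Subgroup.center G) * (Nat.card (ConjClasses.noncenter G) + 1) = Nat.card G := by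
  have hcard : ∀ C ∈ ConjClasses.noncenter G, Nat.card C.carrier = Nat.card (Subgroup.center G) := by
    intro C hCn
    obtain ⟨g, rfl⟩ := ConjClasses.mk_surjective C
    have hg : g ∉ Subgroup.center G := fun h =>
      ((ConjClasses.mk_bijOn G).mapsTo h) hCn
    refine Nat.card_congr ((Equiv.mulRight g⁻¹).subtypeEquiv fun y => ?_)
    rw [ConjClasses.mem_carrier_iff_mk_eq, eq_comm, ConjClasses.mk_eq_mk_iff_isConj,
      hC.isConj_iff_mem_center hclass hg]
    rfl
  rw [← Group.nat_card_center_add_sum_card_noncenter_eq_card G, finsum_mem_congr rfl hcard,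
    ← finsum_set_coe_eq_finsum_mem]
  have := Fintype.ofFinite (ConjClasses.noncenter G)
  rw [finsum_eq_sum_of_fintype, Finset.sum_const, Finset.card_univ, Nat.card_eq_fintype_card
    (α := ConjClasses.noncenter G)]
  simp; ring

/-- A vector space basis over `ZMod p` works, its coordinates being lifted to `0, …, p - 1`;
surjectivity and equal cardinalities give bijectivity. -/
theorem exists_bijective_sum_nsmul {M : Type*} [AddCommGroup M]
    {p k : ℕ} [hp : Fact p.Prime] [Module (ZMod p) M] (hk : Nat.card M = p ^ k) :
    ∃ z : Fin k → M, Function.Bijective fun a : Fin k → Fin p => ∑ j, (a j : ℕ) • z j := by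
  have : Finite M := Nat.finite_of_card_ne_zero (by
    rw [hk]; exact pow_ne_zero _ hp.out.ne_zero)
  have hfin : Module.finrank (ZMod p) M = k := by
    have h := Module.natCard_eq_pow_finrank (K := ZMod p) (V := M)
    rw [Nat.card_zmod] at h
    exact (Nat.pow_right_injective hp.out.two_le (hk.symm.trans h)).symm
  let b := Module.finBasisOfFinrankEq (ZMod p) M hfin
  refine ⟨b, ?_⟩
  have := Fintype.ofFinite M
  rw [Fintype.bijective_iff_surjective_and_card]
  refine ⟨fun x => ⟨fun j => ⟨(b.repr x j).val, ZMod.val_lt _⟩, ?_⟩, ?_⟩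
  · conv_rhs => rw [← b.sum_repr x]
    refine Finset.sum_congr rfl fun j _ => ?_
    conv_rhs => rw [← ZMod.natCast_zmod_val (b.repr x j), Nat.cast_smul_eq_nsmul]
  · rw [← Nat.card_eq_fintype_card (α := M), hk]
    simp

open scoped IsMulCommutative in
theorem exists_isCenterBasis {p k : ℕ} [Fact p.Prime] (hexp : ∀ z : Subgroup.center G, z ^ p = 1)
    (hk : Nat.card (Subgroup.center G) = p ^ k) :
    ∃ z : Fin k → Subgroup.center G, IsCenterBasis p z :=
  let _ : Module (ZMod p) (Additive (Subgroup.center G)) :=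
    AddCommGroup.zmodModule fun x => congrArg Additive.ofMul (hexp x.toMul)
  let ⟨z, hz⟩ := exists_bijective_sum_nsmul (M := Additive (Subgroup.center G)) hk
  ⟨z, fun _ => hexp _, hz⟩

end CaminaGroups

/-! ### Characters of `(ℤ/p)ᵏ` and coordinates on the center -/

section Characters

/-- The value at `a` of the character of `(ℤ/p)ᵏ` with label `α`, for a given root of unity. -/
noncomputable def characterValue {p k : ℕ} (ζ : ℂ) (α a : Fin k → Fin p) : ℂ :=
  ∏ j, ζ ^ ((α j : ℕ) * (a j : ℕ))

variable {p k : ℕ} {ζ : ℂ}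

theorem characterValue_comm (α a : Fin k → Fin p) :
    characterValue ζ α a = characterValue ζ a α := by
  simp only [characterValue, mul_comm]

theorem characterValue_zero_right [NeZero p] (α : Fin k → Fin p) :
    characterValue ζ α 0 = 1 := by
  simp [characterValue]

theorem characterValue_zero_left [NeZero p] (a : Fin k → Fin p) :
    characterValue ζ 0 a = 1 := by
  simp [characterValue]

theorem characterValue_add_right [NeZero p] (hζ : ζ ^ p = 1) (α a b : Fin k → Fin p) :
    characterValue ζ α (a + b) = characterValue ζ α a * characterValue ζ α b := by
  rw [characterValue, characterValue, characterValue, ← Finset.prod_mul_distrib]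
  refine Finset.prod_congr rfl fun j _ => ?_
  have h : (ζ ^ (α j : ℕ)) ^ p = 1 := by rw [← pow_mul, mul_comm, pow_mul, hζ, one_pow]
  rw [Pi.add_apply, Fin.val_add, pow_mul, ← pow_mod_orderOf (ζ ^ (α j : ℕ)),
    Nat.mod_mod_of_dvd _ (orderOf_dvd_of_pow_eq_one h), pow_mod_orderOf, pow_add,
    ← pow_mul, ← pow_mul]

theorem exists_characterValue_ne (hp : 1 < p) (hζ : IsPrimitiveRoot ζ p)
    {α β : Fin k → Fin p} (h : α ≠ β) :
    ∃ a, characterValue ζ α a ≠ characterValue ζ β a := by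
  have : NeZero p := ⟨by omega⟩
  obtain ⟨j, hj⟩ := Function.ne_iff.1 h
  have key : ∀ α : Fin k → Fin p,
      characterValue ζ α (Pi.single j ⟨1, hp⟩) = ζ ^ (α j : ℕ) := fun α => by
    rw [characterValue, Finset.prod_eq_single j]
    · simp
    · intro i _ hi
      simp [Pi.single_eq_of_ne hi]
    · simp
  refine ⟨Pi.single j ⟨1, hp⟩, ?_⟩
  rw [key, key]
  exact fun h' => hj (Fin.ext (hζ.pow_inj (α j).2 (β j).2 h'))

/-- Orthogonality of characters: for `a ≠ 0`, shifting the summation index by some `b` multiplies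
the sum by a character value other than `1`. -/
theorem sum_characterValue [NeZero p] (hp : 1 < p) (hζ : IsPrimitiveRoot ζ p)
    (a : Fin k → Fin p) :
    ∑ α, characterValue ζ α a = if a = 0 then (p : ℂ) ^ k else 0 := by
  split_ifs with h
  · subst h
    simp [characterValue_zero_right]
  · obtain ⟨b, hb⟩ := exists_characterValue_ne hp hζ h
    rw [characterValue_zero_left] at hb
    simp only [characterValue_comm _ a]
    have h1 : ∑ α, characterValue ζ a (α + b) = ∑ α, characterValue ζ a α :=
      Equiv.sum_comp (Equiv.addRight b) fun α => characterValue ζ a α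
    simp only [characterValue_add_right hζ.pow_eq_one, ← Finset.sum_mul] at h1
    by_contra hne
    exact hb ((mul_eq_right₀ hne).1 ((mul_comm _ _).trans h1))

open scoped IsMulCommutative in
/-- The central element with coordinates `a` in the basis `z`. -/
def centerElement {G : Type*} [Group G] (z : Fin k → Subgroup.center G) (a : Fin k → Fin p) :
    Subgroup.center G :=
  ∏ j, z j ^ (a j : ℕ)

variable {G : Type*} [Group G] {z : Fin k → Subgroup.center G}

theorem IsCenterBasis.bijective (hz : IsCenterBasis p z) :
    Function.Bijective (centerElement (p := p) z) := hz.2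

theorem centerElement_zero [NeZero p] : centerElement (p := p) z 0 = 1 := by
  simp [centerElement]

open scoped IsMulCommutative in
theorem IsCenterBasis.centerElement_add [NeZero p] (hz : IsCenterBasis p z)
    (a b : Fin k → Fin p) :
    centerElement z (a + b) = centerElement z a * centerElement z b := by
  rw [centerElement, centerElement, centerElement, ← Finset.prod_mul_distrib]
  refine Finset.prod_congr rfl fun j _ => ?_
  rw [Pi.add_apply, Fin.val_add, ← pow_mod_orderOf,
    Nat.mod_mod_of_dvd _ (orderOf_dvd_of_pow_eq_one (hz.1 j)), pow_mod_orderOf, pow_add]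

end Characters
-- Minimal two-sided ideals and direct sums
section IdealSubspaces

variable {A : Type*} [Ring A] [Algebra ℂ A]

theorem mem_idealSubspace {I : TwoSidedIdeal A} {x : A} : x ∈ idealSubspace I ↔ x ∈ I := by
  simp [idealSubspace, TwoSidedIdeal.mem_asIdeal]

theorem smul_mem_twoSidedIdeal {I : TwoSidedIdeal A} (c : ℂ) {x : A} (hx : x ∈ I) : c • x ∈ I :=
  mem_idealSubspace.1 ((idealSubspace I).smul_mem c (mem_idealSubspace.2 hx))

/-- The two-sided ideal carried by a subspace that absorbs multiplication on both sides. -/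
def twoSidedIdealOfSubspace (S : Submodule ℂ A) (hl : ∀ x, ∀ y ∈ S, x * y ∈ S)
    (hr : ∀ y, ∀ x ∈ S, x * y ∈ S) : TwoSidedIdeal A :=
  TwoSidedIdeal.mk' S S.zero_mem S.add_mem S.neg_mem (hl _ _) (hr _ _)

theorem mem_twoSidedIdealOfSubspace {S : Submodule ℂ A} {hl : ∀ x, ∀ y ∈ S, x * y ∈ S}
    {hr : ∀ y, ∀ x ∈ S, x * y ∈ S} {x : A} : x ∈ twoSidedIdealOfSubspace S hl hr ↔ x ∈ S :=
  TwoSidedIdeal.mem_mk' ..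

theorem idealSubspace_twoSidedIdealOfSubspace {S : Submodule ℂ A} {hl : ∀ x, ∀ y ∈ S, x * y ∈ S}
    {hr : ∀ y, ∀ x ∈ S, x * y ∈ S} : idealSubspace (twoSidedIdealOfSubspace S hl hr) = S := by
  ext x
  rw [mem_idealSubspace, mem_twoSidedIdealOfSubspace]

theorem idealSubspace_span_singleton {w : A} (hl : ∀ x : A, x * w ∈ Submodule.span ℂ {w})
    (hr : ∀ x : A, w * x ∈ Submodule.span ℂ {w}) :
    idealSubspace (TwoSidedIdeal.span {w}) = Submodule.span ℂ {w} := by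
  refine le_antisymm (fun x hx => ?_) ?_
  · rw [mem_idealSubspace, TwoSidedIdeal.mem_span_iff] at hx
    refine mem_twoSidedIdealOfSubspace.1 (hx (twoSidedIdealOfSubspace (Submodule.span ℂ {w})
      (fun x y hy => ?_) fun x y hy => ?_) ?_)
    · obtain ⟨c, rfl⟩ := Submodule.mem_span_singleton.1 hy
      rw [mul_smul_comm]
      exact Submodule.smul_mem _ _ (hl x)
    · obtain ⟨c, rfl⟩ := Submodule.mem_span_singleton.1 hy
      rw [smul_mul_assoc]
      exact Submodule.smul_mem _ _ (hr x)
    · rintro _ rfl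
      exact mem_twoSidedIdealOfSubspace.2 (Submodule.mem_span_singleton_self _)
  · rw [Submodule.span_singleton_le_iff_mem, mem_idealSubspace]
    exact TwoSidedIdeal.subset_span rfl

theorem isAtom_of_finrank_idealSubspace_eq_one {I : TwoSidedIdeal A}
    (h : Module.finrank ℂ (idealSubspace I) = 1) : IsAtom I := by
  obtain ⟨⟨w, hw⟩, hw0, hspan⟩ := finrank_eq_one_iff'.1 h
  rw [mem_idealSubspace] at hw
  replace hw0 : w ≠ 0 := fun h => hw0 (Subtype.ext h)
  refine ⟨fun hbot => hw0 (by rwa [hbot, TwoSidedIdeal.mem_bot] at hw), fun J hJ => ?_⟩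
  by_contra hne
  obtain ⟨x, hxJ, hx0⟩ : ∃ x ∈ J, x ≠ 0 := by
    by_contra! hall
    exact hne (le_bot_iff.1 fun x hx => (TwoSidedIdeal.mem_bot _).2 (hall x hx))
  obtain ⟨c, hc⟩ := hspan ⟨x, mem_idealSubspace.2 (hJ.le hxJ)⟩
  replace hc : c • w = x := congrArg Subtype.val hc
  have hc0 : c ≠ 0 := by
    rintro rfl
    exact hx0 (by rw [← hc, zero_smul])
  have hwJ : w ∈ J := by
    rw [← inv_smul_smul₀ hc0 w, hc]
    exact smul_mem_twoSidedIdeal _ hxJ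
  refine hJ.not_ge fun y hy => ?_
  obtain ⟨d, hd⟩ := hspan ⟨y, mem_idealSubspace.2 hy⟩
  replace hd : d • w = y := congrArg Subtype.val hd
  rw [← hd]
  exact smul_mem_twoSidedIdeal _ hwJ

theorem mul_eq_zero_of_isAtom_of_ne {R : Type*} [Ring R] {I J : TwoSidedIdeal R}
    (hI : IsAtom I) (hJ : IsAtom J)
    (hIJ : I ≠ J) {x y : R} (hx : x ∈ I) (hy : y ∈ J) : x * y = 0 := by
  have h : x * y ∈ I ⊓ J :=
    (TwoSidedIdeal.mem_inf _).2 ⟨I.mul_mem_right _ _ hx, J.mul_mem_left _ _ hy⟩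
  rwa [(hI.disjoint_of_ne hJ hIJ).eq_bot, TwoSidedIdeal.mem_bot] at h

theorem isWedderburnDecomposition_of_one_mem {ι : Type*} {I : ι → TwoSidedIdeal A}
    (hatom : ∀ i, IsAtom (I i)) (hinj : Function.Injective I)
    (hone : 1 ∈ ⨆ i, idealSubspace (I i)) : IsWedderburnDecomposition I := by
  classical
  have htop : ⨆ i, idealSubspace (I i) = ⊤ := by
    refine eq_top_iff.2 fun x _ => ?_
    have h : ⨆ i, idealSubspace (I i) ≤
        (⨆ i, idealSubspace (I i)).comap (LinearMap.mulLeft ℂ x) :=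
      iSup_le fun i y hy => Submodule.mem_iSup_of_mem i <| mem_idealSubspace.2 <|
        (I i).mul_mem_left _ _ (mem_idealSubspace.1 hy)
    simpa using h hone
  refine ⟨hatom, DirectSum.isInternal_submodule_of_iSupIndep_of_iSup_eq_top ?_ htop⟩
  intro i
  rw [Submodule.disjoint_def]
  intro x hxi hx
  -- An `x` in `I i` and in the sum of the others is killed on the left by `I i` (second membership)
  -- and by every other `I j` (first membership), hence by `1`.
  have hker : (⊤ : Submodule ℂ A) ≤ LinearMap.ker (LinearMap.mulRight ℂ x) := by
    rw [← htop]
    refine iSup_le fun j y hy => ?_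
    rw [LinearMap.mem_ker, LinearMap.mulRight_apply]
    by_cases hji : j = i
    · subst hji
      have hle : ⨆ l, ⨆ (_ : l ≠ j), idealSubspace (I l) ≤
          LinearMap.ker (LinearMap.mulLeft ℂ y) :=
        iSup₂_le fun l hl u hu => mul_eq_zero_of_isAtom_of_ne (hatom j) (hatom l)
          (fun h => hl (hinj h).symm) (mem_idealSubspace.1 hy) (mem_idealSubspace.1 hu)
      exact hle hx
    · exact mul_eq_zero_of_isAtom_of_ne (hatom j) (hatom i) (fun h => hji (hinj h))
        (mem_idealSubspace.1 hy) (mem_idealSubspace.1 hxi)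
  simpa using hker (Submodule.mem_top (x := (1 : A)))

/-- The elements of an algebra that map a subspace into itself by left multiplication. -/
def leftStabilizer (S : Submodule ℂ A) : Subalgebra ℂ A where
  carrier := {x | ∀ y ∈ S, x * y ∈ S}
  mul_mem' := fun ha hb y hy => by
    rw [mul_assoc]
    exact ha _ (hb y hy)
  add_mem' := fun ha hb y hy => by
    rw [add_mul]
    exact S.add_mem (ha y hy) (hb y hy)
  algebraMap_mem' := fun c y hy => by
    rw [← Algebra.smul_def]
    exact S.smul_mem c hy

/-- The elements of an algebra that map a subspace into itself by right multiplication. -/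
def rightStabilizer (S : Submodule ℂ A) : Subalgebra ℂ A where
  carrier := {x | ∀ y ∈ S, y * x ∈ S}
  mul_mem' := fun ha hb y hy => by
    rw [← mul_assoc]
    exact hb _ (ha y hy)
  add_mem' := fun ha hb y hy => by
    rw [mul_add]
    exact S.add_mem (ha y hy) (hb y hy)
  algebraMap_mem' := fun c y hy => by
    rw [← Algebra.commutes, ← Algebra.smul_def]
    exact S.smul_mem c hy

/-- Since `e` commutes with every factor, all its copies collapse to one. The list must be nonempty:
an empty product is `1`, not `e`. -/
theorem List.prod_map_corner_pow {ι : Type*} {e : A} (he : IsIdempotentElem e) (x : ι → A)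
    (hx : ∀ i, Commute e (x i)) (c : ι → ℂ) (m : ι → ℕ) {l : List ι} (hl : l ≠ []) :
    (l.map fun i => c i • (e * (e * x i * e) ^ m i)).prod =
      (l.map c).prod • (e * (l.map fun i => x i ^ m i).prod) := by
  have hcorner : ∀ i, e * (e * x i * e) ^ m i = e * x i ^ m i := fun i => by
    rw [mul_assoc, ← (hx i).eq, ← mul_assoc, he.eq, (hx i).mul_pow, ← mul_assoc, ← pow_succ',
      he.pow_succ_eq]
  -- The extra `e` in front makes the identity true for the empty list too, so that induction can
  -- start there.
  have key : ∀ l : List ι, e * (l.map fun i => c i • (e * (e * x i * e) ^ m i)).prod =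
      (l.map c).prod • (e * (l.map fun i => x i ^ m i).prod) := by
    intro l
    induction l with
    | nil => simp
    | cons i l ih =>
      simp only [List.map_cons, List.prod_cons, hcorner] at ih ⊢
      rw [((hx i).pow_right (m i)).eq, smul_mul_assoc, mul_smul_comm, mul_assoc, ih,
        mul_smul_comm, mul_smul_comm, smul_smul, ← mul_assoc, ← mul_assoc, ← mul_assoc,
        ((hx i).pow_right (m i)).eq, mul_assoc (x i ^ m i), he.eq]
  rw [← key]
  obtain ⟨i, l, rfl⟩ := List.exists_cons_of_ne_nil hl
  rw [List.map_cons, List.prod_cons, ← mul_assoc, mul_smul_comm, ← mul_assoc, he.eq]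

end IdealSubspaces
-- Adjacency matrices and dual idempotents
section SchemeMatrices

open Matrix

variable {G : Type*} [Group G]

theorem mk_eq_mk_of_mem_center {z : G} (hz : z ∈ Subgroup.center G) {x : G} :
    ConjClasses.mk x = ConjClasses.mk z ↔ x = z := by
  rw [ConjClasses.mk_eq_mk_iff_isConj, isConj_comm, isConj_iff]
  constructor
  · rintro ⟨c, rfl⟩
    rw [Subgroup.mem_center_iff.1 hz c, mul_inv_cancel_right]
  · rintro rfl
    exact ⟨1, by simp⟩

theorem mk_mem_noncenter_iff [Finite G] {x : G} :
    ConjClasses.mk x ∈ ConjClasses.noncenter G ↔ x ∉ Subgroup.center G := by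
  refine ⟨fun h hx => (ConjClasses.mk_bijOn G).mapsTo hx h, fun h => ?_⟩
  by_contra hn
  obtain ⟨z, hz, hzx⟩ := (ConjClasses.mk_bijOn G).surjOn hn
  rw [(mk_eq_mk_of_mem_center hz).1 hzx.symm] at h
  exact h hz

variable [Fintype G] [DecidableEq G]

open Classical in
theorem adjacencyMatrix_apply (C : ConjClasses G) (x y : G) :
    adjacencyMatrix C x y = if ConjClasses.mk (y * x⁻¹) = C then 1 else 0 := by
  simp only [adjacencyMatrix, of_apply, ConjClasses.mem_carrier_iff_mk_eq]

open Classical in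
theorem dualIdempotent_eq (C : ConjClasses G) :
    dualIdempotent C = diagonal fun y => if ConjClasses.mk y = C then 1 else 0 := by
  simp only [dualIdempotent, adjacencyMatrix_apply, inv_one, mul_one]

theorem terwilligerAlgebra_le {S : Subalgebra ℂ (Matrix G G ℂ)}
    (hA : ∀ C, adjacencyMatrix C ∈ S) (hE : ∀ C, dualIdempotent C ∈ S) :
    terwilligerAlgebra G ≤ S := by
  refine Algebra.adjoin_le (Set.union_subset ?_ ?_)
  · refine (Submodule.span_le (p := Subalgebra.toSubmodule S)).2 ?_
    rintro _ ⟨C, rfl⟩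
    exact hA C
  · refine (Submodule.span_le (p := Subalgebra.toSubmodule S)).2 ?_
    rintro _ ⟨C, rfl⟩
    exact hE C

theorem adjacencyMatrix_center_apply (z : Subgroup.center G) (x y : G) :
    adjacencyMatrix (ConjClasses.mk (z : G)) x y = if y = z * x then 1 else 0 := by
  simp only [adjacencyMatrix_apply, mk_eq_mk_of_mem_center z.2, mul_inv_eq_iff_eq_mul]

theorem adjacencyMatrix_center_mul_apply (z : Subgroup.center G) (M : Matrix G G ℂ) (x y : G) :
    (adjacencyMatrix (ConjClasses.mk (z : G)) * M) x y = M (z * x) y := by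
  simp [mul_apply, adjacencyMatrix_center_apply]

theorem mul_adjacencyMatrix_center_apply (z : Subgroup.center G) (M : Matrix G G ℂ) (x y : G) :
    (M * adjacencyMatrix (ConjClasses.mk (z : G))) x y = M x ((z : G)⁻¹ * y) := by
  simp [mul_apply, adjacencyMatrix_center_apply, ← inv_mul_eq_iff_eq_mul]

theorem adjacencyMatrix_one : adjacencyMatrix (ConjClasses.mk (1 : G)) = 1 := by
  ext x y
  have := adjacencyMatrix_center_apply (G := G) 1 x y
  rw [OneMemClass.coe_one] at this
  rw [this, one_apply, one_mul]
  simp only [eq_comm]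

variable (G) in
/-- The adjacency matrices of the central classes represent the center. -/
noncomputable def centerRepresentation : Subgroup.center G →* Matrix G G ℂ where
  toFun z := adjacencyMatrix (ConjClasses.mk (z : G))
  map_one' := adjacencyMatrix_one
  map_mul' z w := by
    ext x y
    rw [adjacencyMatrix_center_mul_apply, adjacencyMatrix_center_apply,
      adjacencyMatrix_center_apply, Subgroup.coe_mul, ← mul_assoc,
      Subgroup.mem_center_iff.1 z.2 (w : G)]

theorem centerRepresentation_apply (z : Subgroup.center G) :
    centerRepresentation G z = adjacencyMatrix (ConjClasses.mk (z : G)) := rfl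

theorem dualIdempotent_mul_apply (C : ConjClasses G) (M : Matrix G G ℂ) (x y : G)
    [Decidable (ConjClasses.mk x = C)] :
    (dualIdempotent C * M) x y = if ConjClasses.mk x = C then M x y else 0 := by
  classical
  rw [dualIdempotent_eq, diagonal_mul]
  split_ifs <;> simp_all

theorem mul_dualIdempotent_apply (C : ConjClasses G) (M : Matrix G G ℂ) (x y : G)
    [Decidable (ConjClasses.mk y = C)] :
    (M * dualIdempotent C) x y = if ConjClasses.mk y = C then M x y else 0 := by
  classical
  rw [dualIdempotent_eq, mul_diagonal]
  split_ifs <;> simp_all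

theorem isIdempotentElem_dualIdempotent (C : ConjClasses G) :
    IsIdempotentElem (dualIdempotent C) := by
  classical
  ext x y
  rw [dualIdempotent_mul_apply, dualIdempotent_eq, diagonal_apply]
  split_ifs <;> simp_all

theorem dualIdempotent_mul_of_ne {C D : ConjClasses G} (h : C ≠ D) :
    dualIdempotent C * dualIdempotent D = 0 := by
  classical
  ext x y
  rw [dualIdempotent_mul_apply, dualIdempotent_eq, diagonal_apply]
  split_ifs <;> simp_all

theorem sum_dualIdempotent [Fintype (ConjClasses G)] :
    ∑ C : ConjClasses G, dualIdempotent C = 1 := by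
  classical
  ext x y
  rw [Matrix.sum_apply, one_apply]
  simp [dualIdempotent_eq, diagonal_apply]

theorem sum_adjacencyMatrix [Fintype (ConjClasses G)] :
    ∑ C : ConjClasses G, adjacencyMatrix C = of fun _ _ => 1 := by
  classical
  ext x y
  rw [Matrix.sum_apply]
  simp [adjacencyMatrix_apply]

theorem adjacencyMatrix_conj (C : ConjClasses G) (g x y : G) :
    adjacencyMatrix C (g * x * g⁻¹) (g * y * g⁻¹) = adjacencyMatrix C x y := by
  classical
  have h : ConjClasses.mk (g * y * g⁻¹ * (g * x * g⁻¹)⁻¹) = ConjClasses.mk (y * x⁻¹) := by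
    rw [ConjClasses.mk_eq_mk_iff_isConj, isConj_comm, isConj_iff]
    exact ⟨g, by group⟩
  rw [adjacencyMatrix_apply, adjacencyMatrix_apply, h]

end SchemeMatrices

/-! ### The primary component -/

section PrimaryComponent

open Matrix

variable {G : Type*} [Group G]

variable (G) in
/-- Matrices on conjugacy classes, viewed as matrices on the group that are constant on pairs of
classes. -/
noncomputable def classMatrix : Matrix (ConjClasses G) (ConjClasses G) ℂ →ₗ[ℂ] Matrix G G ℂ where
  toFun M := M.submatrix ConjClasses.mk ConjClasses.mk
  map_add' _ _ := rfl
  map_smul' _ _ := rfl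

theorem classMatrix_apply (M : Matrix (ConjClasses G) (ConjClasses G) ℂ) (x y : G) :
    classMatrix G M x y = M (ConjClasses.mk x) (ConjClasses.mk y) := rfl

theorem classMatrix_injective : Function.Injective (classMatrix G) := by
  intro M N h
  ext C D
  obtain ⟨x, rfl⟩ := ConjClasses.mk_surjective C
  obtain ⟨y, rfl⟩ := ConjClasses.mk_surjective D
  exact congrFun (congrFun h x) y

/-- The two indices are conjugated independently. The adjacency matrices are only invariant under
simultaneous conjugation, which still suffices for absorption, after reindexing the sum in the
product. -/
theorem mem_range_classMatrix_iff {N : Matrix G G ℂ} :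
    N ∈ LinearMap.range (classMatrix G) ↔
      ∀ g h x y, N (g * x * g⁻¹) (h * y * h⁻¹) = N x y := by
  have hconj : ∀ g x : G, ConjClasses.mk (g * x * g⁻¹) = ConjClasses.mk x := fun g x => by
    rw [ConjClasses.mk_eq_mk_iff_isConj, isConj_comm, isConj_iff]
    exact ⟨g, rfl⟩
  constructor
  · rintro ⟨M, rfl⟩ g h x y
    rw [classMatrix_apply, classMatrix_apply, hconj, hconj]
  · intro hN
    refine ⟨of fun C D => N (Quotient.out C) (Quotient.out D), ?_⟩
    ext x y
    rw [classMatrix_apply, of_apply]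
    have hx : IsConj x (Quotient.out (ConjClasses.mk x)) :=
      (ConjClasses.mk_eq_mk_iff_isConj.1 (Quotient.out_eq (ConjClasses.mk x))).symm
    have hy : IsConj y (Quotient.out (ConjClasses.mk y)) :=
      (ConjClasses.mk_eq_mk_iff_isConj.1 (Quotient.out_eq (ConjClasses.mk y))).symm
    obtain ⟨g, hg⟩ := isConj_iff.1 hx
    obtain ⟨h, hh⟩ := isConj_iff.1 hy
    rw [← hg, ← hh, hN]

theorem card_carrier_ne_zero [Finite G] (C : ConjClasses G) : (Nat.card C.carrier : ℂ) ≠ 0 := by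
  obtain ⟨x, rfl⟩ := ConjClasses.mk_surjective C
  have : Nonempty (ConjClasses.mk x).carrier := ⟨⟨x, ConjClasses.mem_carrier_mk⟩⟩
  exact Nat.cast_ne_zero.2 Nat.card_pos.ne'

variable [Fintype G] [DecidableEq G]

theorem terwilligerAlgebra_le_leftStabilizer_classMatrix :
    terwilligerAlgebra G ≤ leftStabilizer (LinearMap.range (classMatrix G)) := by
  classical
  refine terwilligerAlgebra_le (fun C N hN => ?_) fun C N hN => ?_
  · rw [mem_range_classMatrix_iff] at hN ⊢
    intro g h x y
    rw [mul_apply, mul_apply, ← Equiv.sum_comp (MulAut.conj g).toEquiv]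
    refine Finset.sum_congr rfl fun w _ => ?_
    change adjacencyMatrix C _ (g * w * g⁻¹) * N (g * w * g⁻¹) _ = _
    rw [adjacencyMatrix_conj, hN]
  · obtain ⟨M, rfl⟩ := hN
    refine ⟨of fun D F => if D = C then M D F else 0, ?_⟩
    ext x y
    rw [dualIdempotent_mul_apply]
    rfl

theorem terwilligerAlgebra_le_rightStabilizer_classMatrix :
    terwilligerAlgebra G ≤ rightStabilizer (LinearMap.range (classMatrix G)) := by
  classical
  refine terwilligerAlgebra_le (fun C N hN => ?_) fun C N hN => ?_
  · rw [mem_range_classMatrix_iff] at hN ⊢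
    intro g h x y
    rw [mul_apply, mul_apply, ← Equiv.sum_comp (MulAut.conj h).toEquiv]
    refine Finset.sum_congr rfl fun w _ => ?_
    change N _ (h * w * h⁻¹) * adjacencyMatrix C (h * w * h⁻¹) _ = _
    rw [adjacencyMatrix_conj, hN]
  · obtain ⟨M, rfl⟩ := hN
    refine ⟨of fun D F => if F = C then M D F else 0, ?_⟩
    ext x y
    rw [mul_dualIdempotent_apply]
    rfl

theorem classMatrix_single [DecidableEq (ConjClasses G)] (C D : ConjClasses G) (c : ℂ) :
    classMatrix G (single C D c) =
      c • (dualIdempotent C * (of fun _ _ => 1) * dualIdempotent D) := by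
  ext x y
  rw [classMatrix_apply, Matrix.smul_apply, mul_dualIdempotent_apply, dualIdempotent_mul_apply,
    single_apply]
  simp only [eq_comm (a := C), eq_comm (a := D)]
  split_ifs <;> simp_all

theorem classMatrix_mem_terwilligerAlgebra (M : Matrix (ConjClasses G) (ConjClasses G) ℂ) :
    classMatrix G M ∈ terwilligerAlgebra G := by
  classical
  rw [matrix_eq_sum_single M, map_sum]
  refine sum_mem fun C _ => ?_
  rw [map_sum]
  refine sum_mem fun D _ => ?_
  rw [classMatrix_single, ← sum_adjacencyMatrix]
  exact Subalgebra.smul_mem _ (mul_mem (mul_mem (dualT C).2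
    (sum_mem fun F _ => (adjacencyT F).2)) (dualT D).2) _

variable (G) in
/-- The class matrices as elements of the Terwilliger algebra. -/
noncomputable def classMatrixT :
    Matrix (ConjClasses G) (ConjClasses G) ℂ →ₗ[ℂ] terwilligerAlgebra G :=
  (classMatrix G).codRestrict (Subalgebra.toSubmodule (terwilligerAlgebra G))
    classMatrix_mem_terwilligerAlgebra

theorem coe_classMatrixT (M : Matrix (ConjClasses G) (ConjClasses G) ℂ) :
    (classMatrixT G M : Matrix G G ℂ) = classMatrix G M := rfl

theorem classMatrixT_injective : Function.Injective (classMatrixT G) := fun _ _ h =>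
  classMatrix_injective (congrArg Subtype.val h)

theorem mem_range_classMatrixT_iff {t : terwilligerAlgebra G} :
    t ∈ LinearMap.range (classMatrixT G) ↔ (t : Matrix G G ℂ) ∈ LinearMap.range (classMatrix G) :=
  ⟨fun ⟨M, hM⟩ => ⟨M, congrArg Subtype.val hM⟩, fun ⟨M, hM⟩ => ⟨M, Subtype.ext hM⟩⟩

variable (G) in
/-- The ideal of the Terwilliger algebra formed by the matrices that are constant on pairs of
conjugacy classes. -/
noncomputable def primaryIdeal : TwoSidedIdeal (terwilligerAlgebra G) :=
  twoSidedIdealOfSubspace (LinearMap.range (classMatrixT G))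
    (fun x _ hy => mem_range_classMatrixT_iff.2 <|
      terwilligerAlgebra_le_leftStabilizer_classMatrix x.2 _ (mem_range_classMatrixT_iff.1 hy))
    (fun y _ hx => mem_range_classMatrixT_iff.2 <|
      terwilligerAlgebra_le_rightStabilizer_classMatrix y.2 _ (mem_range_classMatrixT_iff.1 hx))

theorem mem_primaryIdeal_iff {t : terwilligerAlgebra G} :
    t ∈ primaryIdeal G ↔ (t : Matrix G G ℂ) ∈ LinearMap.range (classMatrix G) :=
  mem_twoSidedIdealOfSubspace.trans mem_range_classMatrixT_iff

theorem classMatrixT_mem_primaryIdeal (M : Matrix (ConjClasses G) (ConjClasses G) ℂ) :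
    classMatrixT G M ∈ primaryIdeal G :=
  mem_primaryIdeal_iff.2 ⟨M, rfl⟩

theorem finrank_primaryIdeal :
    Module.finrank ℂ (idealSubspace (primaryIdeal G)) = Nat.card (ConjClasses G) ^ 2 := by
  have := Fintype.ofFinite (ConjClasses G)
  rw [primaryIdeal, idealSubspace_twoSidedIdealOfSubspace,
    LinearMap.finrank_range_of_inj classMatrixT_injective, Module.finrank_matrix,
    Nat.card_eq_fintype_card]
  simp [sq]

/-- Summing over the middle index class by class produces the class sizes as weights. They are
nonzero, so the usual matrix-unit proof of simplicity survives. -/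
theorem classMatrixT_mul [Fintype (ConjClasses G)] [DecidableEq (ConjClasses G)]
    (M N : Matrix (ConjClasses G) (ConjClasses G) ℂ) :
    classMatrixT G M * classMatrixT G N =
      classMatrixT G (M * diagonal (fun C => (Nat.card C.carrier : ℂ)) * N) := by
  apply Subtype.ext
  ext x y
  rw [MulMemClass.coe_mul, coe_classMatrixT, coe_classMatrixT, coe_classMatrixT, mul_apply,
    classMatrix_apply, mul_apply, ← Finset.sum_fiberwise Finset.univ ConjClasses.mk]
  refine Finset.sum_congr rfl fun C _ => ?_
  have h : ∀ w ∈ Finset.univ.filter (fun w : G => ConjClasses.mk w = C),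
      classMatrix G M x w * classMatrix G N w y =
        M (ConjClasses.mk x) C * N C (ConjClasses.mk y) := fun w hw => by
    rw [classMatrix_apply, classMatrix_apply, (Finset.mem_filter.1 hw).2]
  rw [Finset.sum_congr rfl h, Finset.sum_const, mul_diagonal, nsmul_eq_mul]
  have hcard : Nat.card C.carrier =
      (Finset.univ.filter fun w : G => ConjClasses.mk w = C).card := by
    rw [Nat.card_eq_card_toFinset]
    congr 1
    ext w
    simp [ConjClasses.mem_carrier_iff_mk_eq]
  rw [hcard]
  ring

theorem isAtom_primaryIdeal : IsAtom (primaryIdeal G) := by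
  classical
  refine ⟨fun hbot => ?_, fun J hJ => ?_⟩
  · have h := classMatrixT_mem_primaryIdeal (G := G) (of fun _ _ => 1)
    rw [hbot, TwoSidedIdeal.mem_bot] at h
    simpa [coe_classMatrixT, classMatrix_apply] using
      congrFun (congrFun (congrArg Subtype.val h) 1) 1
  · by_contra hne
    obtain ⟨x, hxJ, hx0⟩ : ∃ x ∈ J, x ≠ 0 := by
      by_contra! hall
      exact hne (le_bot_iff.1 fun x hx => (TwoSidedIdeal.mem_bot _).2 (hall x hx))
    obtain ⟨M, hM⟩ := mem_range_classMatrixT_iff.2 (mem_primaryIdeal_iff.1 (hJ.le hxJ))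
    subst hM
    obtain ⟨C, D, hCD⟩ : ∃ C D, M C D ≠ 0 := by
      by_contra! hall
      exact hx0 (by rw [show M = 0 from Matrix.ext hall, map_zero])
    -- Multiplying by matrix units on both sides moves the nonzero entry `M C D` to position `(C',
    -- D')`, scaled by the sizes of `C` and `D`.
    have hsingle : ∀ C' D' c, classMatrixT G (single C' D' c) ∈ J := fun C' D' c => by
      have h := J.mul_mem_right _ (classMatrixT G (single D D' 1))
        (J.mul_mem_left (classMatrixT G (single C' C 1)) _ hxJ)
      rw [classMatrixT_mul, classMatrixT_mul, mul_assoc _ (diagonal _) M, mul_assoc (single C' C 1),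
        single_mul_mul_single, one_mul, mul_one, mul_diagonal, diagonal_mul] at h
      have h0 : (Nat.card C.carrier : ℂ) * M C D * Nat.card D.carrier ≠ 0 :=
        mul_ne_zero (mul_ne_zero (card_carrier_ne_zero C) hCD) (card_carrier_ne_zero D)
      have h' := smul_mem_twoSidedIdeal
        (c * ((Nat.card C.carrier : ℂ) * M C D * Nat.card D.carrier)⁻¹) h
      rwa [← map_smul, smul_single, smul_eq_mul, inv_mul_cancel_right₀ h0] at h'
    refine hJ.not_ge fun y hy => ?_
    obtain ⟨N, rfl⟩ := mem_range_classMatrixT_iff.2 (mem_primaryIdeal_iff.1 hy)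
    rw [matrix_eq_sum_single N, map_sum]
    refine sum_mem fun C' _ => ?_
    rw [map_sum]
    exact sum_mem fun D' _ => hsingle C' D' _

theorem dualT_mem_primaryIdeal_of_mem_center {z : G} (hz : z ∈ Subgroup.center G) :
    dualT (ConjClasses.mk z) ∈ primaryIdeal G := by
  classical
  refine mem_primaryIdeal_iff.2 ⟨single (ConjClasses.mk z) (ConjClasses.mk z) 1, ?_⟩
  ext x y
  change _ = dualIdempotent (ConjClasses.mk z) x y
  rw [classMatrix_apply, dualIdempotent_eq, diagonal_apply, single_apply]
  simp only [eq_comm (a := ConjClasses.mk z), mk_eq_mk_of_mem_center hz]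
  split_ifs <;> simp_all

theorem isPrimaryComponent_iff {I : TwoSidedIdeal (terwilligerAlgebra G)} :
    IsPrimaryComponent I ↔ I = primaryIdeal G := by
  classical
  -- The base vector is fixed by `E_1^*`, which lies in the primary ideal; so `t B` acts on it as `t
  -- B E_1^*`, and this product vanishes when `t` is in another minimal ideal.
  have hmul : ∀ M : Matrix G G ℂ, (M * dualIdempotent (ConjClasses.mk 1)).mulVec
      (Pi.single (1 : G) (1 : ℂ)) = M.mulVec (Pi.single 1 1) := fun M => by
    ext x
    rw [mulVec_single_one, mulVec_single_one]
    simp [mul_dualIdempotent_apply, col_apply]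
  have hone : dualT (ConjClasses.mk (1 : G)) ∈ primaryIdeal G :=
    dualT_mem_primaryIdeal_of_mem_center (one_mem _)
  constructor
  · rintro ⟨hI, t, ht, v, ⟨B, hB, rfl⟩, hne⟩
    by_contra hIV
    have hBT : B ∈ terwilligerAlgebra G := Algebra.subset_adjoin (Or.inl hB)
    have h0 := mul_eq_zero_of_isAtom_of_ne hI isAtom_primaryIdeal hIV
      (I.mul_mem_right t ⟨B, hBT⟩ ht) hone
    apply hne
    have h1 : (t : Matrix G G ℂ) * B * dualIdempotent (ConjClasses.mk 1) = 0 :=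
      congrArg Subtype.val h0
    have h2 := hmul ((t : Matrix G G ℂ) * B)
    rw [h1, zero_mulVec, ← mulVec_mulVec] at h2
    exact h2.symm
  · rintro rfl
    refine ⟨isAtom_primaryIdeal, _, hone, Pi.single 1 1,
      ⟨1, ?_, one_mulVec _⟩, fun h => ?_⟩
    · rw [← adjacencyMatrix_one]
      exact Submodule.subset_span ⟨_, rfl⟩
    · have h1 := hmul 1
      rw [one_mul, one_mulVec] at h1
      have h2 := congrFun (h1.symm.trans h) 1
      simp at h2

end PrimaryComponent
-- Character idempotents on non-central classes
section CharacterIdempotents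

open Matrix

/-- Multiplication by central elements preserves every non-central conjugacy class. -/
def CenterFixesNoncenter (G : Type*) [Group G] : Prop :=
  ∀ (c : Subgroup.center G) (x : G), x ∉ Subgroup.center G →
    ConjClasses.mk (c * x) = ConjClasses.mk x

theorem CenterFixesNoncenter.mk_mul_eq_iff {G : Type*} [Group G] [Finite G]
    (hG : CenterFixesNoncenter G) {D : ConjClasses G} (hD : D ∈ ConjClasses.noncenter G)
    (c : Subgroup.center G) (x : G) : ConjClasses.mk (c * x) = D ↔ ConjClasses.mk x = D := by
  constructor
  · intro h
    have := hG c⁻¹ _ (mk_mem_noncenter_iff.1 (h ▸ hD))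
    rw [Subgroup.coe_inv, inv_mul_cancel_left] at this
    rw [this, h]
  · intro h
    rw [hG _ _ (mk_mem_noncenter_iff.1 (h ▸ hD)), h]

variable {G : Type*} [Group G] [Fintype G] [DecidableEq G] {p k : ℕ} {ζ : ℂ}
  {z : Fin k → Subgroup.center G}

/-- The component at the class `C` of the idempotent of a character of the center. -/
noncomputable def characterMatrix (z : Fin k → Subgroup.center G) (ζ : ℂ) (C : ConjClasses G)
    (α : Fin k → Fin p) : Matrix G G ℂ :=
  (1 / (p : ℂ) ^ k) • ∑ a : Fin k → Fin p, characterValue ζ α a •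
    (dualIdempotent C * centerRepresentation G (centerElement z a))

theorem commute_dualIdempotent_centerRepresentation
    (hG : CenterFixesNoncenter G)
    {C : ConjClasses G} (hC : C ∈ ConjClasses.noncenter G) (c : Subgroup.center G) :
    Commute (dualIdempotent C) (centerRepresentation G c) := by
  classical
  ext x y
  rw [centerRepresentation_apply, dualIdempotent_mul_apply, mul_dualIdempotent_apply,
    adjacencyMatrix_center_apply]
  by_cases hy : y = c * x
  · rw [hy]
    simp only [hG.mk_mul_eq_iff hC]
  · simp only [if_neg hy, ite_self]

-- This replaces the ordered product of corner powers by a single central translation. The condition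
-- `k ≠ 0` keeps that product nonempty, so that the factor `E_C^*` is present.
open scoped IsMulCommutative in
theorem coe_characterIdempotent
    (hG : CenterFixesNoncenter G)
    {C : ConjClasses G} (hC : C ∈ ConjClasses.noncenter G) (hk : k ≠ 0) (α : Fin k → Fin p) :
    (characterIdempotent z ζ C α : Matrix G G ℂ) = characterMatrix z ζ C α := by
  have hval : ∀ t : terwilligerAlgebra G, (t : Matrix G G ℂ) = (terwilligerAlgebra G).val t :=
    fun _ => rfl
  rw [characterIdempotent, characterMatrix, hval, map_smul, map_sum]
  congr 1
  refine Finset.sum_congr rfl fun a _ => ?_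
  rw [map_list_prod, List.map_ofFn, List.ofFn_eq_map]
  have h := List.prod_map_corner_pow (isIdempotentElem_dualIdempotent C)
    (fun j => centerRepresentation G (z j))
    (fun j => commute_dualIdempotent_centerRepresentation hG hC (z j))
    (fun j => ζ ^ ((α j : ℕ) * (a j : ℕ))) (fun j => (a j : ℕ))
    (l := List.finRange k) (by simpa using hk)
  refine Eq.trans ?_ (h.trans ?_)
  · congr 1
  · rw [characterValue, ← List.prod_ofFn, List.ofFn_eq_map, centerElement, ← List.prod_ofFn,
      List.ofFn_eq_map, map_list_prod, List.map_map]
    simp only [Function.comp_def, map_pow]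

/-- Shifting the summation index by `b` shows that the translation by `b` acts on `W_C(α)` as the
inverse of the character value. -/
theorem centerRepresentation_mul_characterMatrix [NeZero p]
    (hG : CenterFixesNoncenter G)
    (hz : IsCenterBasis p z) (hζ : ζ ^ p = 1) {C : ConjClasses G}
    (hC : C ∈ ConjClasses.noncenter G) (α b : Fin k → Fin p) :
    characterValue ζ α b • (centerRepresentation G (centerElement z b) * characterMatrix z ζ C α) =
      characterMatrix z ζ C α := by
  rw [characterMatrix, mul_smul_comm, smul_comm]
  congr 1
  conv_rhs => rw [← Equiv.sum_comp (Equiv.addLeft b)]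
  rw [Finset.mul_sum, Finset.smul_sum]
  refine Finset.sum_congr rfl fun a _ => ?_
  conv_rhs => rw [Equiv.coe_addLeft, characterValue_add_right hζ, hz.centerElement_add, map_mul,
    ← mul_assoc, (commute_dualIdempotent_centerRepresentation hG hC _).eq, mul_assoc]
  rw [mul_smul_comm, smul_smul]

theorem dualIdempotent_mul_characterMatrix_self (C : ConjClasses G) (α : Fin k → Fin p) :
    dualIdempotent C * characterMatrix z ζ C α = characterMatrix z ζ C α := by
  rw [characterMatrix, mul_smul_comm, Finset.mul_sum]
  simp only [mul_smul_comm, ← mul_assoc, (isIdempotentElem_dualIdempotent C).eq]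

theorem commute_characterMatrix_centerRepresentation
    (hG : CenterFixesNoncenter G) {C : ConjClasses G}
    (hC : C ∈ ConjClasses.noncenter G) (α : Fin k → Fin p) (c : Subgroup.center G) :
    Commute (centerRepresentation G c) (characterMatrix z ζ C α) := by
  rw [characterMatrix]
  refine (Commute.sum_right _ _ _ fun a _ => ?_).smul_right _
  refine Commute.smul_right (Commute.mul_right ?_ ?_) _
  · exact (commute_dualIdempotent_centerRepresentation hG hC c).symm
  · rw [Commute, SemiconjBy, ← map_mul, ← map_mul]
    congr 1
    exact Subtype.ext (Subgroup.mem_center_iff.1 (centerElement z a).2 c)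

theorem commute_dualIdempotent_characterMatrix
    (hG : CenterFixesNoncenter G) {C : ConjClasses G}
    (hC : C ∈ ConjClasses.noncenter G) (α : Fin k → Fin p) (D : ConjClasses G) :
    Commute (dualIdempotent D) (characterMatrix z ζ C α) := by
  obtain rfl | hD := eq_or_ne D C
  · rw [characterMatrix]
    refine (Commute.sum_right _ _ _ fun a _ => ?_).smul_right _
    exact ((Commute.refl _).mul_right
      (commute_dualIdempotent_centerRepresentation hG hC _)).smul_right _
  · rw [Commute, SemiconjBy]
    rw [characterMatrix, mul_smul_comm, smul_mul_assoc, Finset.mul_sum, Finset.sum_mul]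
    congr 1
    refine Finset.sum_congr rfl fun a _ => ?_
    rw [mul_smul_comm, smul_mul_assoc, ← mul_assoc, dualIdempotent_mul_of_ne hD,
      (commute_dualIdempotent_centerRepresentation hG hC _).eq, mul_assoc,
      dualIdempotent_mul_of_ne hD.symm, zero_mul, mul_zero]

theorem adjacencyMatrix_mul_centerRepresentation
    (hG : CenterFixesNoncenter G) {D : ConjClasses G}
    (hD : D ∈ ConjClasses.noncenter G) (c : Subgroup.center G) :
    adjacencyMatrix D * centerRepresentation G c = adjacencyMatrix D ∧
      centerRepresentation G c * adjacencyMatrix D = adjacencyMatrix D := by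
  classical
  constructor <;> ext x y
  · rw [centerRepresentation_apply, mul_adjacencyMatrix_center_apply, adjacencyMatrix_apply,
      adjacencyMatrix_apply, mul_assoc]
    have := hG.mk_mul_eq_iff hD c⁻¹ (y * x⁻¹)
    rw [Subgroup.coe_inv] at this
    simp only [this]
  · rw [centerRepresentation_apply, adjacencyMatrix_center_mul_apply, adjacencyMatrix_apply,
      adjacencyMatrix_apply]
    have h1 : y * ((c : G) * x)⁻¹ = (c : G)⁻¹ * (y * x⁻¹) := by
      rw [_root_.mul_inv_rev, ← mul_assoc]
      exact Subgroup.mem_center_iff.1 (inv_mem c.2) _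
    have := hG.mk_mul_eq_iff hD c⁻¹ (y * x⁻¹)
    rw [Subgroup.coe_inv] at this
    simp only [h1, this]

theorem adjacencyMatrix_mul_characterMatrix (hp : 1 < p)
    (hG : CenterFixesNoncenter G)
    (hz : IsCenterBasis p z) (hζ : IsPrimitiveRoot ζ p) {C D : ConjClasses G}
    (hC : C ∈ ConjClasses.noncenter G) (hD : D ∈ ConjClasses.noncenter G) {α : Fin k → Fin p}
    (hα : ∃ j, (α j : ℕ) ≠ 0) :
    adjacencyMatrix D * characterMatrix z ζ C α = 0 ∧
      characterMatrix z ζ C α * adjacencyMatrix D = 0 := by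
  have : NeZero p := ⟨by omega⟩
  have hα0 : α ≠ 0 := by
    rintro rfl
    simp at hα
  obtain ⟨b, hb⟩ := exists_characterValue_ne hp hζ hα0
  rw [characterValue_zero_left] at hb
  -- `A_D` absorbs the translation by `b`, whereas `W_C(α)` turns it into a scalar different from
  -- `1`; the product must therefore vanish.
  have key : ∀ X : Matrix G G ℂ, characterValue ζ α b • X = X → X = 0 := fun X hX => by
    have h : (characterValue ζ α b - 1) • X = 0 := by rw [sub_smul, hX, one_smul, sub_self]
    exact (smul_eq_zero.1 h).resolve_left (sub_ne_zero.2 hb)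
  obtain ⟨h1, h2⟩ := adjacencyMatrix_mul_centerRepresentation hG hD (centerElement z b)
  have hW := centerRepresentation_mul_characterMatrix hG hz hζ.pow_eq_one hC α b
  constructor
  · apply key
    conv_rhs => rw [← hW, mul_smul_comm, ← mul_assoc, h1]
  · apply key
    conv_rhs => rw [← hW, (commute_characterMatrix_centerRepresentation hG hC α _).eq,
      smul_mul_assoc, mul_assoc, h2]

/-- Each of the `p ^ k` summands of the left factor fixes `W_C(α)`, which cancels the normalization.
-/
theorem isIdempotentElem_characterMatrix (hp : 1 < p)
    (hG : CenterFixesNoncenter G)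
    (hz : IsCenterBasis p z) (hζ : IsPrimitiveRoot ζ p) {C : ConjClasses G}
    (hC : C ∈ ConjClasses.noncenter G) (α : Fin k → Fin p) :
    IsIdempotentElem (characterMatrix z ζ C α) := by
  have : NeZero p := ⟨by omega⟩
  rw [IsIdempotentElem]
  nth_rw 1 [characterMatrix]
  rw [smul_mul_assoc, Finset.sum_mul]
  have h : ∀ a : Fin k → Fin p, characterValue ζ α a • (dualIdempotent C *
      centerRepresentation G (centerElement z a)) * characterMatrix z ζ C α =
        characterMatrix z ζ C α := fun a => by
    rw [smul_mul_assoc, mul_assoc, ← mul_smul_comm,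
      centerRepresentation_mul_characterMatrix hG hz hζ.pow_eq_one hC,
      dualIdempotent_mul_characterMatrix_self]
  rw [Finset.sum_congr rfl fun a _ => h a, Finset.sum_const, Finset.card_univ,
    ← Nat.cast_smul_eq_nsmul ℂ, smul_smul]
  have hp0 : (p : ℂ) ≠ 0 := Nat.cast_ne_zero.2 (by omega)
  simp [hp0]

theorem terwilligerAlgebra_mul_characterMatrix (hp : 1 < p)
    (hG : CenterFixesNoncenter G)
    (hz : IsCenterBasis p z) (hζ : IsPrimitiveRoot ζ p) {C : ConjClasses G}
    (hC : C ∈ ConjClasses.noncenter G) {α : Fin k → Fin p} (hα : ∃ j, (α j : ℕ) ≠ 0)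
    (t : terwilligerAlgebra G) :
    (t : Matrix G G ℂ) * characterMatrix z ζ C α ∈ Submodule.span ℂ {characterMatrix z ζ C α} ∧
      Commute (t : Matrix G G ℂ) (characterMatrix z ζ C α) := by
  have : NeZero p := ⟨by omega⟩
  set W := characterMatrix z ζ C α with hWdef
  -- Both properties define subalgebras, so they need checking only on the generators.
  have hle : terwilligerAlgebra G ≤
      leftStabilizer (Submodule.span ℂ {W}) ⊓ Subalgebra.centralizer ℂ {W} := by
    have hmem : ∀ X : Matrix G G ℂ, X * W ∈ Submodule.span ℂ {W} → Commute X W →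
        X ∈ leftStabilizer (Submodule.span ℂ {W}) ⊓ Subalgebra.centralizer ℂ {W} := by
      refine fun X h1 h2 => ⟨fun y hy => ?_, ?_⟩
      · obtain ⟨c, rfl⟩ := Submodule.mem_span_singleton.1 hy
        rw [mul_smul_comm]
        exact Submodule.smul_mem _ _ h1
      · rw [SetLike.mem_coe, Subalgebra.mem_centralizer_iff]
        rintro _ rfl
        exact h2.symm
    refine terwilligerAlgebra_le (fun D => ?_) fun D => ?_
    · by_cases hD : D ∈ ConjClasses.noncenter G
      · obtain ⟨h1, h2⟩ := adjacencyMatrix_mul_characterMatrix hp hG hz hζ hC hD hα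
        refine hmem _ ?_ (h1.trans h2.symm)
        rw [h1]
        exact zero_mem _
      · obtain ⟨x, rfl⟩ := ConjClasses.mk_surjective D
        rw [mk_mem_noncenter_iff, not_not] at hD
        obtain ⟨b, hb⟩ := hz.bijective.2 ⟨x, hD⟩
        have hxb : adjacencyMatrix (ConjClasses.mk x) =
            centerRepresentation G (centerElement z b) := by
          rw [hb]
          rfl
        rw [hxb]
        refine hmem _ ?_ (commute_characterMatrix_centerRepresentation hG hC α _)
        have h0 : characterValue ζ α b ≠ 0 :=
          Finset.prod_ne_zero_iff.2 fun j _ => pow_ne_zero _ (hζ.ne_zero (by omega))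
        refine Submodule.mem_span_singleton.2 ⟨(characterValue ζ α b)⁻¹, ?_⟩
        conv_lhs => rw [hWdef, ← centerRepresentation_mul_characterMatrix hG hz hζ.pow_eq_one hC α b]
        rw [inv_smul_smul₀ h0]
    · refine hmem _ ?_ (commute_dualIdempotent_characterMatrix hG hC α D)
      obtain rfl | hD := eq_or_ne D C
      · rw [hWdef, dualIdempotent_mul_characterMatrix_self]
        exact Submodule.mem_span_singleton_self _
      · rw [hWdef, ← dualIdempotent_mul_characterMatrix_self, ← mul_assoc,
          dualIdempotent_mul_of_ne hD, zero_mul]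
        exact zero_mem _
  obtain ⟨h1, h2⟩ := hle t.2
  exact ⟨h1 _ (Submodule.mem_span_singleton_self _),
    ((Subalgebra.mem_centralizer_iff ℂ).1 h2 W rfl).symm⟩

theorem characterMatrix_apply (hz : IsCenterBasis p z) (C : ConjClasses G)
    (α a : Fin k → Fin p) (x : G) [Decidable (ConjClasses.mk x = C)] :
    characterMatrix z ζ C α x (centerElement z a * x) =
      if ConjClasses.mk x = C then 1 / (p : ℂ) ^ k * characterValue ζ α a else 0 := by
  rw [characterMatrix, Matrix.smul_apply, Matrix.sum_apply, smul_eq_mul]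
  simp only [Matrix.smul_apply, dualIdempotent_mul_apply, centerRepresentation_apply,
    adjacencyMatrix_center_apply]
  split_ifs
  · rw [Finset.sum_eq_single a]
    · simp
    · intro b _ hb
      rw [if_neg, smul_zero]
      intro h
      exact hb (hz.bijective.1 (Subtype.ext (mul_right_cancel h))).symm
    · simp
  · simp

theorem sum_characterMatrix (hp : 1 < p) (hζ : IsPrimitiveRoot ζ p) (C : ConjClasses G) :
    ∑ α : Fin k → Fin p, characterMatrix z ζ C α = dualIdempotent C := by
  have : NeZero p := ⟨by omega⟩
  have hp0 : (p : ℂ) ≠ 0 := Nat.cast_ne_zero.2 (by omega)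
  simp only [characterMatrix]
  rw [← Finset.smul_sum, Finset.sum_comm]
  simp only [← Finset.sum_smul, sum_characterValue hp hζ]
  simp [centerElement_zero, hp0]

/-- Here a non-central class must be a full coset of the center, not just a union of cosets: the
averaged translations then fill the whole block `C × C`. -/
theorem characterMatrix_zero_mem_range [NeZero p] (hz : IsCenterBasis p z)
    (hG : ∀ x : G, x ∉ Subgroup.center G → ∀ y,
      ConjClasses.mk x = ConjClasses.mk y ↔ y * x⁻¹ ∈ Subgroup.center G)
    {C : ConjClasses G} (hC : C ∈ ConjClasses.noncenter G) :
    characterMatrix z ζ C (0 : Fin k → Fin p) ∈ LinearMap.range (classMatrix G) := by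
  classical
  refine ⟨single C C (1 / (p : ℂ) ^ k), ?_⟩
  ext x y
  rw [classMatrix_apply, single_apply]
  by_cases hx : ConjClasses.mk x = C
  · have hxc : x ∉ Subgroup.center G := mk_mem_noncenter_iff.1 (hx ▸ hC)
    by_cases hy : ConjClasses.mk y = C
    · obtain ⟨a, ha⟩ := hz.bijective.2 ⟨_, (hG x hxc y).1 (hx.trans hy.symm)⟩
      have hya : y = centerElement z a * x := by rw [ha]; simp
      rw [if_pos ⟨hx.symm, hy.symm⟩, hya, characterMatrix_apply hz, if_pos hx,
        characterValue_zero_left, mul_one]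
    · rw [if_neg fun h => hy h.2.symm, characterMatrix, Matrix.smul_apply, Matrix.sum_apply,
        Finset.sum_eq_zero, smul_zero]
      intro a _
      rw [Matrix.smul_apply, dualIdempotent_mul_apply, if_pos hx, centerRepresentation_apply,
        adjacencyMatrix_center_apply, if_neg, smul_zero]
      rintro rfl
      exact hy (((hG x hxc _).2 (by simp)).symm.trans hx)
  · rw [if_neg fun h => hx h.1.symm, ← dualIdempotent_mul_characterMatrix_self,
      dualIdempotent_mul_apply, if_neg hx]

end CharacterIdempotents

/-! ### The Wedderburn decomposition -/

section CaminaTerwilliger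

variable {G : Type*} [Group G] [Fintype G] [DecidableEq G] {p k : ℕ} {ζ : ℂ}
  {z : Fin k → Subgroup.center G}

theorem isIdempotentElem_characterIdempotent (hp : 1 < p) (hG : CenterFixesNoncenter G)
    (hz : IsCenterBasis p z) (hζ : IsPrimitiveRoot ζ p) {C : ConjClasses G}
    (hC : C ∈ ConjClasses.noncenter G) (hk : k ≠ 0) (α : Fin k → Fin p) :
    IsIdempotentElem (characterIdempotent z ζ C α) := by
  apply Subtype.ext
  rw [MulMemClass.coe_mul, coe_characterIdempotent hG hC hk]
  exact isIdempotentElem_characterMatrix hp hG hz hζ hC α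

theorem characterIdempotent_apply_self (hp : 1 < p) (hG : CenterFixesNoncenter G)
    (hz : IsCenterBasis p z) {C : ConjClasses G} (hC : C ∈ ConjClasses.noncenter G) (hk : k ≠ 0)
    (α : Fin k → Fin p) (x : G) [Decidable (ConjClasses.mk x = C)] :
    (characterIdempotent z ζ C α : Matrix G G ℂ) x x =
      if ConjClasses.mk x = C then 1 / (p : ℂ) ^ k else 0 := by
  have : NeZero p := ⟨by omega⟩
  have h := characterMatrix_apply (ζ := ζ) hz C α 0 x
  rwa [centerElement_zero, OneMemClass.coe_one, one_mul, characterValue_zero_right, mul_one,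
    ← coe_characterIdempotent hG hC hk] at h

theorem characterIdempotent_ne_zero (hp : 1 < p) (hG : CenterFixesNoncenter G)
    (hz : IsCenterBasis p z) {C : ConjClasses G} (hC : C ∈ ConjClasses.noncenter G) (hk : k ≠ 0)
    (α : Fin k → Fin p) : characterIdempotent z ζ C α ≠ 0 := by
  classical
  obtain ⟨x, rfl⟩ := ConjClasses.mk_surjective C
  intro h
  have h1 := characterIdempotent_apply_self (ζ := ζ) hp hG hz hC hk α x
  have hp0 : (p : ℂ) ≠ 0 := Nat.cast_ne_zero.2 (by omega)
  rw [h, if_pos rfl] at h1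
  exact one_div_ne_zero (pow_ne_zero k hp0) h1.symm

theorem idealSubspace_span_characterIdempotent (hp : 1 < p) (hG : CenterFixesNoncenter G)
    (hz : IsCenterBasis p z) (hζ : IsPrimitiveRoot ζ p) {C : ConjClasses G}
    (hC : C ∈ ConjClasses.noncenter G) {α : Fin k → Fin p} (hα : ∃ j, (α j : ℕ) ≠ 0) :
    idealSubspace (TwoSidedIdeal.span {characterIdempotent z ζ C α}) =
      Submodule.span ℂ {characterIdempotent z ζ C α} := by
  have hk : k ≠ 0 := by
    rintro rfl
    exact hα.choose.elim0
  have hl : ∀ t, t * characterIdempotent z ζ C α ∈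
      Submodule.span ℂ {characterIdempotent z ζ C α} := fun t => by
    obtain ⟨c, hc⟩ := Submodule.mem_span_singleton.1
      (terwilligerAlgebra_mul_characterMatrix hp hG hz hζ hC hα t).1
    refine Submodule.mem_span_singleton.2 ⟨c, Subtype.ext ?_⟩
    rw [MulMemClass.coe_mul, coe_characterIdempotent hG hC hk, ← hc, Subalgebra.coe_smul,
      coe_characterIdempotent hG hC hk]
  refine idealSubspace_span_singleton hl fun t => ?_
  have hcomm : t * characterIdempotent z ζ C α = characterIdempotent z ζ C α * t := by
    apply Subtype.ext
    rw [MulMemClass.coe_mul, MulMemClass.coe_mul, coe_characterIdempotent hG hC hk]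
    exact (terwilligerAlgebra_mul_characterMatrix hp hG hz hζ hC hα t).2
  rw [← hcomm]
  exact hl t

theorem finrank_span_characterIdempotent (hp : 1 < p) (hG : CenterFixesNoncenter G)
    (hz : IsCenterBasis p z) (hζ : IsPrimitiveRoot ζ p) {C : ConjClasses G}
    (hC : C ∈ ConjClasses.noncenter G) {α : Fin k → Fin p} (hα : ∃ j, (α j : ℕ) ≠ 0) :
    Module.finrank ℂ (idealSubspace (TwoSidedIdeal.span {characterIdempotent z ζ C α})) = 1 := by
  have hk : k ≠ 0 := by
    rintro rfl
    exact hα.choose.elim0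
  rw [idealSubspace_span_characterIdempotent hp hG hz hζ hC hα]
  exact finrank_span_singleton (characterIdempotent_ne_zero hp hG hz hC hk α)

/-- A class matrix has equal entries at `(x, x)` and `(x, z x)` for central `z`, while those of
`W_C(α)` differ by a character value that can be chosen different from `1`. -/
theorem characterIdempotent_notMem_primaryIdeal (hp : 1 < p) (hG : CenterFixesNoncenter G)
    (hz : IsCenterBasis p z) (hζ : IsPrimitiveRoot ζ p) {C : ConjClasses G}
    (hC : C ∈ ConjClasses.noncenter G) {α : Fin k → Fin p} (hα : ∃ j, (α j : ℕ) ≠ 0) :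
    characterIdempotent z ζ C α ∉ primaryIdeal G := by
  classical
  have : NeZero p := ⟨by omega⟩
  have hk : k ≠ 0 := by
    rintro rfl
    exact hα.choose.elim0
  intro h
  obtain ⟨M, hM⟩ := mem_primaryIdeal_iff.1 h
  have hα0 : α ≠ 0 := by
    rintro rfl
    simp at hα
  obtain ⟨b, hb⟩ := exists_characterValue_ne hp hζ hα0
  obtain ⟨x, rfl⟩ := ConjClasses.mk_surjective C
  have h1 := characterIdempotent_apply_self (ζ := ζ) hp hG hz hC hk α x
  have h2 := characterMatrix_apply (ζ := ζ) hz (ConjClasses.mk x) α b x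
  rw [← coe_characterIdempotent hG hC hk, ← hM, classMatrix_apply,
    hG _ _ (mk_mem_noncenter_iff.1 hC), ← classMatrix_apply M, hM, h1, if_pos rfl, if_pos rfl] at h2
  have hp0 : (p : ℂ) ≠ 0 := Nat.cast_ne_zero.2 (by omega)
  refine hb ?_
  rw [characterValue_zero_left]
  exact ((mul_eq_left₀ (one_div_ne_zero (pow_ne_zero k hp0))).1 h2.symm)

theorem eq_of_characterIdempotent_mem_span (hp : 1 < p) (hG : CenterFixesNoncenter G)
    (hz : IsCenterBasis p z) (hζ : IsPrimitiveRoot ζ p) (hk : k ≠ 0) {C D : ConjClasses G}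
    (hC : C ∈ ConjClasses.noncenter G) (hD : D ∈ ConjClasses.noncenter G) {α β : Fin k → Fin p}
    (h : characterIdempotent z ζ C α ∈ Submodule.span ℂ {characterIdempotent z ζ D β}) :
    C = D ∧ α = β := by
  classical
  have hp0 : (1 / (p : ℂ) ^ k) ≠ 0 :=
    one_div_ne_zero (pow_ne_zero k (Nat.cast_ne_zero.2 (by omega)))
  obtain ⟨c, hc⟩ := Submodule.mem_span_singleton.1 h
  obtain ⟨x, rfl⟩ := ConjClasses.mk_surjective C
  have hentry : ∀ y, c * (characterIdempotent z ζ D β : Matrix G G ℂ) x y =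
      (characterIdempotent z ζ (ConjClasses.mk x) α : Matrix G G ℂ) x y := fun y => by
    rw [← hc]
    rfl
  -- The diagonal entry forces the classes to agree and the scalar `c` to be `1`; the entries at
  -- central translates of `x` then compare the two characters.
  have h1 := hentry x
  rw [characterIdempotent_apply_self hp hG hz hC hk, characterIdempotent_apply_self hp hG hz hD hk,
    if_pos rfl] at h1
  have hCD : ConjClasses.mk x = D := by
    by_contra hne
    rw [if_neg hne, mul_zero] at h1
    exact hp0 h1.symm
  refine ⟨hCD, ?_⟩
  rw [if_pos hCD, mul_eq_right₀ hp0] at h1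
  by_contra hαβ
  obtain ⟨a, ha⟩ := exists_characterValue_ne hp hζ hαβ
  have h2 := hentry (centerElement z a * x)
  rw [coe_characterIdempotent hG hC hk, coe_characterIdempotent hG hD hk, characterMatrix_apply hz,
    characterMatrix_apply hz, if_pos rfl, if_pos hCD, h1, one_mul] at h2
  exact ha (mul_left_cancel₀ hp0 h2).symm

theorem isWedderburnDecomposition_terwilligerAlgebra (hp : 1 < p)
    (hG : ∀ x : G, x ∉ Subgroup.center G → ∀ y,
      ConjClasses.mk x = ConjClasses.mk y ↔ y * x⁻¹ ∈ Subgroup.center G)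
    (hz : IsCenterBasis p z) (hζ : IsPrimitiveRoot ζ p) (hk : k ≠ 0) :
    IsWedderburnDecomposition
      (fun i : Option (ConjClasses.noncenter G ×
          {α : Fin k → Fin p // ∃ j, (α j : ℕ) ≠ 0}) =>
        i.elim (primaryIdeal G) fun Cα =>
          TwoSidedIdeal.span {characterIdempotent z ζ Cα.1.1 Cα.2.1}) := by
  classical
  have : NeZero p := ⟨by omega⟩
  have hG' : CenterFixesNoncenter G := fun c x hx => ((hG x hx _).2 (by simp)).symm
  have := Fintype.ofFinite (ConjClasses G)
  refine isWedderburnDecomposition_of_one_mem ?_ ?_ ?_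
  · rintro (_ | ⟨⟨C, hC⟩, α, hα⟩)
    · exact isAtom_primaryIdeal
    · exact isAtom_of_finrank_idealSubspace_eq_one
        (finrank_span_characterIdempotent hp hG' hz hζ hC hα)
  · rintro (_ | ⟨⟨C, hC⟩, α, hα⟩) (_ | ⟨⟨D, hD⟩, β, hβ⟩) h
    · rfl
    · refine absurd ?_ (characterIdempotent_notMem_primaryIdeal hp hG' hz hζ hD hβ)
      change primaryIdeal G = TwoSidedIdeal.span {characterIdempotent z ζ D β} at h
      rw [h]
      exact TwoSidedIdeal.subset_span rfl
    · refine absurd ?_ (characterIdempotent_notMem_primaryIdeal hp hG' hz hζ hC hα)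
      change TwoSidedIdeal.span {characterIdempotent z ζ C α} = primaryIdeal G at h
      rw [← h]
      exact TwoSidedIdeal.subset_span rfl
    · change TwoSidedIdeal.span {characterIdempotent z ζ C α} =
        TwoSidedIdeal.span {characterIdempotent z ζ D β} at h
      have hmem : characterIdempotent z ζ C α ∈
          Submodule.span ℂ {characterIdempotent z ζ D β} := by
        rw [← idealSubspace_span_characterIdempotent hp hG' hz hζ hD hβ, mem_idealSubspace, ← h]
        exact TwoSidedIdeal.subset_span rfl
      obtain ⟨rfl, rfl⟩ := eq_of_characterIdempotent_mem_span hp hG' hz hζ hk hC hD hmem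
      rfl
  -- For central `C` the dual idempotent is already in the primary ideal; for non-central `C` it is
  -- the sum of `W_C(α)` over all `α`, with `α = 0` in the primary ideal.
  · have hsum : (1 : terwilligerAlgebra G) = ∑ C : ConjClasses G, dualT C := by
      apply Subtype.ext
      rw [AddSubmonoidClass.coe_finsetSum]
      exact sum_dualIdempotent.symm
    rw [hsum]
    refine sum_mem fun C _ => ?_
    by_cases hC : C ∈ ConjClasses.noncenter G
    · have hdual : dualT C = ∑ α : Fin k → Fin p, characterIdempotent z ζ C α := by
        apply Subtype.ext
        rw [AddSubmonoidClass.coe_finsetSum]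
        simp only [coe_characterIdempotent hG' hC hk, sum_characterMatrix hp hζ]
        rfl
      rw [hdual]
      refine sum_mem fun α _ => ?_
      by_cases hα : ∃ j, (α j : ℕ) ≠ 0
      · refine Submodule.mem_iSup_of_mem (some (⟨C, hC⟩, ⟨α, hα⟩)) (mem_idealSubspace.2 ?_)
        exact TwoSidedIdeal.subset_span rfl
      · refine Submodule.mem_iSup_of_mem none (mem_idealSubspace.2 (mem_primaryIdeal_iff.2 ?_))
        have hα0 : α = 0 := by
          push Not at hα
          exact funext fun j => Fin.ext (by simpa using hα j)
        rw [hα0, coe_characterIdempotent hG' hC hk]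
        exact characterMatrix_zero_mem_range hz hG hC
    · obtain ⟨x, rfl⟩ := ConjClasses.mk_surjective C
      rw [mk_mem_noncenter_iff, not_not] at hC
      exact Submodule.mem_iSup_of_mem none
        (mem_idealSubspace.2 (dualT_mem_primaryIdeal_of_mem_center hC))

end CaminaTerwilliger

theorem theorem5 (G : Type*) [Group G] [Fintype G] [DecidableEq G] (p n k : ℕ)
    (hp : p.Prime) (hCamina : IsCamina G) (hclass : Group.nilpotencyClass G = 2)
    (hn : Nat.card G = p ^ n) (hk : Nat.card (Subgroup.center G) = p ^ k) :
    Nat.card (ConjClasses.noncenter G) = p ^ (n - k) - 1 ∧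
    (∃ z : Fin k → Subgroup.center G, IsCenterBasis p z) ∧
    ∃ V : TwoSidedIdeal (terwilligerAlgebra G),
      (∀ I : TwoSidedIdeal (terwilligerAlgebra G), IsPrimaryComponent I ↔ I = V) ∧
      Module.finrank ℂ (idealSubspace V) = Nat.card (ConjClasses G) ^ 2 ∧
      ∀ (z : Fin k → Subgroup.center G) (ζ : ℂ), IsCenterBasis p z → IsPrimitiveRoot ζ p →
        (∀ C ∈ ConjClasses.noncenter G, ∀ α : Fin k → Fin p, (∃ j, (α j : ℕ) ≠ 0) →
          IsIdempotentElem (characterIdempotent z ζ C α) ∧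
          Module.finrank ℂ (idealSubspace (TwoSidedIdeal.span {characterIdempotent z ζ C α})) = 1) ∧
        IsWedderburnDecomposition
          (fun i : Option (ConjClasses.noncenter G ×
              {α : Fin k → Fin p // ∃ j, (α j : ℕ) ≠ 0}) =>
            i.elim V fun Cα =>
              TwoSidedIdeal.span {characterIdempotent z ζ Cα.1.1 Cα.2.1}) := by
  have : Fact p.Prime := ⟨hp⟩
  have hpG : IsPGroup p G := IsPGroup.of_card hn
  have : Group.IsNilpotent G := hpG.isNilpotent
  have hmk : ∀ x : G, x ∉ Subgroup.center G → ∀ y,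
      ConjClasses.mk x = ConjClasses.mk y ↔ y * x⁻¹ ∈ Subgroup.center G := fun x hx y => by
    rw [ConjClasses.mk_eq_mk_iff_isConj, hCamina.isConj_iff_mem_center hclass hx]
  have hG : CenterFixesNoncenter G := fun c x hx => ((hmk x hx _).2 (by simp)).symm
  -- A trivial center would make `G'` trivial, contradicting class two.
  have hk0 : k ≠ 0 := by
    rintro rfl
    rw [pow_zero, Subgroup.card_eq_one] at hk
    have hcomm := hCamina.center_eq_commutator hclass
    rw [hk, ← Subgroup.top_lowerCentralSeries_one, eq_comm,
      Subgroup.lowerCentralSeries_eq_bot_iff_nilpotencyClass_le] at hcomm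
    omega
  refine ⟨?_, exists_isCenterBasis (hCamina.center_pow_eq_one hclass hpG) hk, primaryIdeal G,
    fun I => isPrimaryComponent_iff, finrank_primaryIdeal, fun z ζ hz hζ =>
    ⟨fun C hC α hα => ⟨isIdempotentElem_characterIdempotent hp.one_lt hG hz hζ hC hk0 α,
      finrank_span_characterIdempotent hp.one_lt hG hz hζ hC hα⟩,
      isWedderburnDecomposition_terwilligerAlgebra hp.one_lt hmk hz hζ hk0⟩⟩
  have hcard := hCamina.card_noncenter hclass
  rw [hn, hk] at hcard
  have hkn : k ≤ n := (Nat.pow_dvd_pow_iff_le_right hp.one_lt).1 ⟨_, hcard.symm⟩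
  have h : p ^ k * (Nat.card (ConjClasses.noncenter G) + 1) = p ^ k * p ^ (n - k) := by
    rw [hcard, ← pow_add, Nat.add_sub_cancel' hkn]
  have := Nat.eq_of_mul_eq_mul_left (pow_pos hp.pos k) h
  omega
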